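/- An *ep-groupoid* $(O,\boldsymbol{O})$ is a small category all of whose morphisms are invertible, whose object set $O$ and morphism set $\boldsymbol{O}$ are smooth finite-dimensional (Hausdorff, paracompact) manifolds, possibly with boundary or corners, whose structure maps (source $s$, target $t$, multiplication, unit, inverse) are smooth, such that (étale) $s,t:\boldsymbol{O}\to O$ are surjective local diffeomorphisms, and (proper) every $x\in O$ has an open neighborhood $V$ for which $t:s^{-1}(\overline{V})\to O$ is a proper map. Its *orbit space* $|O|=O/\!\sim$, where $x\sim x'$ if there is a morphism from $x$ to $x'$, carries the quotient topology. An *orbifold structure* on a second-countable, paracompact, Hausdorff topological space $\mathcal{O}$ is an ep-groupoid $(O,\boldsymbol{O})$ together with a homeomorphism $|O|\simeq\mathcal{O}$. A manifold $\mathcal{M}$ has the *trivial orbifold structure* $(M,\boldsymbol{M})$ with $M=\mathcal{M}$, $\boldsymbol{M}=\{\mathrm{id}_x : x\in\mathcal{M}\}\simeq \mathcal M$ and the canonical homeomorphism $|M|\simeq\mathcal{M}$. A *smooth functor* between ep-groupoids is a functor that is smooth on objects and on morphisms; it induces a continuous map of orbit spaces $[x]\mapsto[\hat h(x)]$, and hence,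 through the given homeomorphisms, a continuous map of the underlying topological spaces. **Theorem (Whitney approximation).** Let $\mathcal{O}$ be a second-countable, paracompact, Hausdorff topological space with an orbifold structure $(O,\boldsymbol{O})$, and let $\mathcal{M}$ be a smooth finite-dimensional, second-countable, Hausdorff manifold without boundary, with its trivial orbifold structure $(M,\boldsymbol{M})$. Let $f:\mathcal{O}\to\mathcal{M}$ be a continuous map. Then there exists a smooth functor $\hat h:(O,\boldsymbol{O})\to(M,\boldsymbol{M})$ such that the induced continuous map $h=|\hat h|:\mathcal{O}\to\mathcal{M}$ is homotopic to $f$. Furthermore, if $f$ is proper, then $\hat h$ can be chosen such that $h$ is also proper. -/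

import Mathlib

open scoped Manifold ContDiff Topology

/-- An *ep-groupoid* (étale proper Lie groupoid) with manifold of objects `O` and manifold of
morphisms `Mor`, both modelled on `I` (boundary and corners are allowed).

A morphism `φ` goes from `s φ` to `t φ`. The composite `m φ ψ` ("`φ` after `ψ`") is meaningful
only if `s φ = t ψ`; its values at other pairs are irrelevant, all laws and the smoothness of `m`
being required on the set of composable pairs only. As `s` and `t` are local
diffeomorphisms, that set is a submanifold of `Mor × Mor`. -/
structure EpGroupoid {E : Type*} [NormedAddCommGroup E] [NormedSpace ℝ E]
    {H : Type*} [TopologicalSpace H] (I : ModelWithCorners ℝ E H)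
    (O : Type*) [TopologicalSpace O] [ChartedSpace H O]
    (Mor : Type*) [TopologicalSpace Mor] [ChartedSpace H Mor] where
  /-- source -/
  s : Mor → O
  /-- target -/
  t : Mor → O
  /-- multiplication (composition) -/
  m : Mor → Mor → Mor
  /-- unit -/
  u : O → Mor
  /-- inverse -/
  i : Mor → Mor
  s_unit : ∀ x, s (u x) = x
  t_unit : ∀ x, t (u x) = x
  s_comp : ∀ φ ψ, s φ = t ψ → s (m φ ψ) = s ψ
  t_comp : ∀ φ ψ, s φ = t ψ → t (m φ ψ) = t φ
  unit_comp : ∀ φ, m (u (t φ)) φ = φ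
  comp_unit : ∀ φ, m φ (u (s φ)) = φ
  assoc : ∀ φ ψ χ, s φ = t ψ → s ψ = t χ → m (m φ ψ) χ = m φ (m ψ χ)
  s_inv : ∀ φ, s (i φ) = t φ
  t_inv : ∀ φ, t (i φ) = s φ
  inv_comp : ∀ φ, m (i φ) φ = u (s φ)
  comp_inv : ∀ φ, m φ (i φ) = u (t φ)
  contMDiff_s : ContMDiff I I ∞ s
  contMDiff_t : ContMDiff I I ∞ t
  contMDiffOn_m : ContMDiffOn (I.prod I) I ∞ (fun p : Mor × Mor => m p.1 p.2)
    {p : Mor × Mor | s p.1 = t p.2}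
  contMDiff_u : ContMDiff I I ∞ u
  contMDiff_i : ContMDiff I I ∞ i
  surjective_s : Function.Surjective s
  surjective_t : Function.Surjective t
  /-- étale -/
  isLocalDiffeomorph_s : IsLocalDiffeomorph I I ∞ s
  /-- étale -/
  isLocalDiffeomorph_t : IsLocalDiffeomorph I I ∞ t
  /-- proper: `t : s⁻¹(closure V) → O` is a proper map for some open neighbourhood `V` of `x` -/
  proper : ∀ x : O, ∃ V : Set O, IsOpen V ∧ x ∈ V ∧
    IsProperMap (fun φ : s ⁻¹' closure V => t (φ : Mor))

namespace EpGroupoid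

section Orbit

variable {E : Type*} [NormedAddCommGroup E] [NormedSpace ℝ E]
  {H : Type*} [TopologicalSpace H] {I : ModelWithCorners ℝ E H}
  {O : Type*} [TopologicalSpace O] [ChartedSpace H O]
  {Mor : Type*} [TopologicalSpace Mor] [ChartedSpace H Mor]

/-- `x ∼ x'` if there is a morphism from `x` to `x'`. -/
def orbitSetoid (G : EpGroupoid I O Mor) : Setoid O where
  r x x' := ∃ φ, G.s φ = x ∧ G.t φ = x'
  iseqv :=
    { refl := fun x => ⟨G.u x, G.s_unit x, G.t_unit x⟩
      symm := by
        rintro x y ⟨φ, hs, ht⟩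
        exact ⟨G.i φ, (G.s_inv φ).trans ht, (G.t_inv φ).trans hs⟩
      trans := by
        rintro x y z ⟨φ, hs, ht⟩ ⟨ψ, hs', ht'⟩
        have h : G.s ψ = G.t φ := hs'.trans ht.symm
        exact ⟨G.m ψ φ, (G.s_comp ψ φ h).trans hs, (G.t_comp ψ φ h).trans ht'⟩ }

/-- The orbit space `|O| = O / ∼`, with the quotient topology. -/
abbrev OrbitSpace (G : EpGroupoid I O Mor) : Type _ := Quotient G.orbitSetoid

end Orbit

/-- The ep-groupoid of a manifold `M` whose only morphisms are the identities: the set of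
morphisms `{id_x | x ∈ M}` is identified with `M`. -/
def trivial {E : Type*} [NormedAddCommGroup E] [NormedSpace ℝ E]
    {H : Type*} [TopologicalSpace H] (I : ModelWithCorners ℝ E H)
    (M : Type*) [TopologicalSpace M] [ChartedSpace H M] : EpGroupoid I M M where
  s := id
  t := id
  m φ _ := φ
  u := id
  i := id
  s_unit _ := rfl
  t_unit _ := rfl
  s_comp _ _ h := h
  t_comp _ _ _ := rfl
  unit_comp _ := rfl
  comp_unit _ := rfl
  assoc _ _ _ _ _ := rfl
  s_inv _ := rfl
  t_inv _ := rfl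
  inv_comp _ := rfl
  comp_inv _ := rfl
  contMDiff_s := contMDiff_id
  contMDiff_t := contMDiff_id
  contMDiffOn_m := contMDiff_fst.contMDiffOn
  contMDiff_u := contMDiff_id
  contMDiff_i := contMDiff_id
  surjective_s := Function.surjective_id
  surjective_t := Function.surjective_id
  isLocalDiffeomorph_s := (Diffeomorph.refl I M ∞).isLocalDiffeomorph
  isLocalDiffeomorph_t := (Diffeomorph.refl I M ∞).isLocalDiffeomorph
  proper _ := ⟨Set.univ, isOpen_univ, Set.mem_univ _,
    (isClosed_closure.preimage continuous_id).isClosedEmbedding_subtypeVal.isProperMap⟩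

end EpGroupoid

/-- An *orbifold structure* on the topological space `X`: an ep-groupoid together with a
homeomorphism from its orbit space to `X`. -/
structure OrbifoldStructure {E : Type*} [NormedAddCommGroup E] [NormedSpace ℝ E]
    {H : Type*} [TopologicalSpace H] (I : ModelWithCorners ℝ E H)
    (O : Type*) [TopologicalSpace O] [ChartedSpace H O]
    (Mor : Type*) [TopologicalSpace Mor] [ChartedSpace H Mor]
    (X : Type*) [TopologicalSpace X] where
  groupoid : EpGroupoid I O Mor
  homeo : groupoid.OrbitSpace ≃ₜ X

/-- The trivial orbifold structure on a manifold `M`: the ep-groupoid with only identity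
morphisms, and the canonical homeomorphism `|M| ≃ M`, `[x] ↦ x`. -/
def OrbifoldStructure.trivial {E : Type*} [NormedAddCommGroup E] [NormedSpace ℝ E]
    {H : Type*} [TopologicalSpace H] (I : ModelWithCorners ℝ E H)
    (M : Type*) [TopologicalSpace M] [ChartedSpace H M] : OrbifoldStructure I M M M where
  groupoid := EpGroupoid.trivial I M
  homeo :=
    { toFun := Quotient.lift id (by rintro x y ⟨φ, hs, ht⟩; exact hs.symm.trans ht)
      invFun := Quotient.mk _
      left_inv := by rintro ⟨x⟩; rfl
      right_inv := fun _ => rfl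
      continuous_toFun := continuous_id.quotient_lift _
      continuous_invFun := continuous_quotient_mk' }

/-- A `C^k` functor between ep-groupoids: a functor which is `C^k` on objects and on
morphisms. -/
structure EpFunctor {E : Type*} [NormedAddCommGroup E] [NormedSpace ℝ E]
    {H : Type*} [TopologicalSpace H] {I : ModelWithCorners ℝ E H}
    {O : Type*} [TopologicalSpace O] [ChartedSpace H O]
    {Mor : Type*} [TopologicalSpace Mor] [ChartedSpace H Mor]
    {E' : Type*} [NormedAddCommGroup E'] [NormedSpace ℝ E']
    {H' : Type*} [TopologicalSpace H'] {I' : ModelWithCorners ℝ E' H'}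
    {P : Type*} [TopologicalSpace P] [ChartedSpace H' P]
    {Mor' : Type*} [TopologicalSpace Mor'] [ChartedSpace H' Mor']
    (k : WithTop ℕ∞) (G : EpGroupoid I O Mor) (G' : EpGroupoid I' P Mor') where
  obj : O → P
  mor : Mor → Mor'
  s_mor : ∀ φ, G'.s (mor φ) = obj (G.s φ)
  t_mor : ∀ φ, G'.t (mor φ) = obj (G.t φ)
  mor_unit : ∀ x, mor (G.u x) = G'.u (obj x)
  mor_comp : ∀ φ ψ, G.s φ = G.t ψ → mor (G.m φ ψ) = G'.m (mor φ) (mor ψ)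
  contMDiff_obj : ContMDiff I I' k obj
  contMDiff_mor : ContMDiff I I' k mor

namespace EpFunctor

variable {E : Type*} [NormedAddCommGroup E] [NormedSpace ℝ E]
  {H : Type*} [TopologicalSpace H] {I : ModelWithCorners ℝ E H}
  {O : Type*} [TopologicalSpace O] [ChartedSpace H O]
  {Mor : Type*} [TopologicalSpace Mor] [ChartedSpace H Mor]
  {E' : Type*} [NormedAddCommGroup E'] [NormedSpace ℝ E']
  {H' : Type*} [TopologicalSpace H'] {I' : ModelWithCorners ℝ E' H'}
  {P : Type*} [TopologicalSpace P] [ChartedSpace H' P]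
  {Mor' : Type*} [TopologicalSpace Mor'] [ChartedSpace H' Mor']
  {k : WithTop ℕ∞}

/-- The continuous map `|F| : |O| → |P|`, `[x] ↦ [F x]`, of orbit spaces induced by a functor. -/
def orbitMap {G : EpGroupoid I O Mor} {G' : EpGroupoid I' P Mor'} (F : EpFunctor k G G') :
    C(G.OrbitSpace, G'.OrbitSpace) where
  toFun := Quotient.map F.obj (by
    rintro x y ⟨φ, rfl, rfl⟩
    exact ⟨F.mor φ, F.s_mor φ, F.t_mor φ⟩)
  continuous_toFun := F.contMDiff_obj.continuous.quotient_map' _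

/-- The continuous map `X → Y` of underlying topological spaces induced by a functor between
orbifold structures on `X` and `Y`. -/
def inducedMap {X : Type*} [TopologicalSpace X] {Y : Type*} [TopologicalSpace Y]
    {S : OrbifoldStructure I O Mor X} {S' : OrbifoldStructure I' P Mor' Y}
    (F : EpFunctor k S.groupoid S'.groupoid) : C(X, Y) :=
  ((S'.homeo : C(S'.groupoid.OrbitSpace, Y)).comp F.orbitMap).comp
    (S.homeo.symm : C(X, S.groupoid.OrbitSpace))

end EpFunctor

/-!
Write `π : O → X` for the projection onto the orbit space. A functor into the trivial orbifold
structure of `M` is the same as a continuous map `h : X → M` for which `h ∘ π` is smooth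
(`OrbifoldStructure.exists_inducedMap_eq`), so `f` has to be deformed into such a map.

*Smooth functions on `X`.* A smooth function `ψ` with compact support on `O` is made invariant by
summing over morphisms, `y ↦ ∑ ψ (t φ)` over all `φ` with `s φ = y`. By properness the sums are
finite, and since `s` is étale they are locally finite sums of smooth functions
(`EpGroupoid.contMDiff_finsum_source_fiber`). Precomposition with a morphism shows invariance. With
`ψ` a bump function this gives smooth bumps on `X` (`EpGroupoid.hasSmoothBumps_quotientMk`), without
any choice of local isotropy groups, hence partitions of unity and smooth solutions of convex
selection problems (`HasSmoothBumps.exists_forall_mem_convex`).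

*Smoothing.* Instead of embedding `M` in a Euclidean space, `f` is smoothed chart by chart. Cover
`M` by a locally finite sequence of open sets `U n`, relatively compact in chart domains, with a
closed shrinking `K n`. The `n`-th step adds to the map, in the `n`-th chart, a small cut-off
correction which makes it smooth at the points of `f ⁻¹' K n`, keeps the points where it was
smooth already, and changes nothing outside `f ⁻¹' U n`
(`HasSmoothBumps.exists_homotopy_contMDiffAt_of_mem_chart`). It is applied to a whole homotopy that
starts at `f`, so that the homotopies need not be concatenated: the sequence is locally eventually
constant, and its limit is the homotopy from `f` to `h`
(`HasSmoothBumps.exists_contMDiff_homotopic`). All steps stay in an open neighbourhood of the graph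
of `f`, in which `f x` and `h x` always lie in a common `U n`; therefore `h` is proper if `f` is.
-/

open Set Function Filter

/-! ### Convex selections from smooth bumps -/

/-- The map `π : O → X` from a manifold *has smooth bumps* if every neighbourhood `U` of every
point `x` of `X` supports a nonnegative function which is positive at `x` and whose pullback
along `π` is smooth. -/
def HasSmoothBumps {E : Type*} [NormedAddCommGroup E] [NormedSpace ℝ E]
    {H : Type*} [TopologicalSpace H] (I : ModelWithCorners ℝ E H)
    {O : Type*} [TopologicalSpace O] [ChartedSpace H O] {X : Type*} [TopologicalSpace X]
    (π : O → X) : Prop :=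
  ∀ x, ∀ U ∈ 𝓝 x, ∃ g : X → ℝ, ContMDiff I 𝓘(ℝ, ℝ) ∞ (g ∘ π) ∧ (∀ y, 0 ≤ g y) ∧ 0 < g x ∧
    support g ⊆ U

section

variable {E : Type*} [NormedAddCommGroup E] [NormedSpace ℝ E]
  {H : Type*} [TopologicalSpace H] {I : ModelWithCorners ℝ E H}
  {O : Type*} [TopologicalSpace O] [ChartedSpace H O]
  {X : Type*} [TopologicalSpace X] {π : O → X}

/-- If the convex sets `t x` locally contain a common point, then there is a function `g` with smooth
pullback and `g x ∈ t x` for all `x`: a combination of such points by means of the partition of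
unity obtained from a locally finite family of bumps. -/
theorem HasSmoothBumps.exists_forall_mem_convex [T2Space X] [WeaklyLocallyCompactSpace X]
    [SigmaCompactSpace X] (hb : HasSmoothBumps I π) (hπ : Topology.IsQuotientMap π)
    {F : Type*} [NormedAddCommGroup F] [NormedSpace ℝ F] {t : X → Set F}
    (ht : ∀ x, Convex ℝ (t x)) (hc : ∀ x, ∃ c, ∀ᶠ y in 𝓝 x, c ∈ t y) :
    ∃ g : X → F, Continuous g ∧ ContMDiff I 𝓘(ℝ, F) ∞ (g ∘ π) ∧ ∀ x, g x ∈ t x := by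
  choose c hc using hc
  have hcont : ∀ {g : X → ℝ}, ContMDiff I 𝓘(ℝ, ℝ) ∞ (g ∘ π) → Continuous g := fun h =>
    hπ.continuous_iff.2 h.continuous
  have hB : ∀ x, (𝓝 x).HasBasis
      (fun g : X → ℝ => ContMDiff I 𝓘(ℝ, ℝ) ∞ (g ∘ π) ∧ (∀ y, 0 ≤ g y) ∧ 0 < g x ∧
        support g ⊆ {y | c x ∈ t y}) (fun g => support g) := by
    refine fun x => ⟨fun N => ⟨fun hN => ?_, ?_⟩⟩
    · obtain ⟨g, h1, h2, h3, h4⟩ := hb x _ (inter_mem hN (hc x))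
      exact ⟨g, ⟨h1, h2, h3, h4.trans inter_subset_right⟩, h4.trans inter_subset_left⟩
    · rintro ⟨g, ⟨h1, -, h3, -⟩, hN⟩
      exact mem_of_superset ((hcont h1).isOpen_support.mem_nhds h3.ne') hN
  obtain ⟨α, z, ρ, hρ, hcov, hlf⟩ := refinement_of_locallyCompact_sigmaCompact_of_nhds_basis hB
  have hlfπ : LocallyFinite fun a => support (ρ a ∘ π) := hlf.preimage_continuous hπ.continuous
  have hfin : ∀ y, HasFiniteSupport fun a => ρ a y := fun y => hlf.point_finite y
  set σ : X → ℝ := fun y => ∑ᶠ a, ρ a y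
  have hσpos : ∀ y, 0 < σ y := by
    intro y
    obtain ⟨a, ha⟩ := iUnion_eq_univ_iff.1 hcov y
    exact finsum_pos (fun i => (hρ i).2.1 y) ⟨a, ((hρ a).2.1 y).lt_of_ne' ha⟩ (hfin y)
  have hσsmooth : ContMDiff I 𝓘(ℝ, ℝ) ∞ (σ ∘ π) := contMDiff_finsum (fun a => (hρ a).1) hlfπ
  have hsmooth : ContMDiff I 𝓘(ℝ, F) ∞
      ((fun y => ∑ᶠ a, (ρ a y / σ y) • c (z a)) ∘ π) := by
    refine contMDiff_finsum (fun a => ?_) (hlfπ.subset fun a y hy => ?_)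
    · refine ContMDiff.smul (ContMDiff.div₀ (hρ a).1 hσsmooth fun y => (hσpos _).ne')
        contMDiff_const
    · intro h
      exact hy (by simp only [comp_apply] at h; simp [h])
  refine ⟨_, hπ.continuous_iff.2 hsmooth.continuous, hsmooth, fun x => ?_⟩
  refine (ht x).finsum_mem (fun a => div_nonneg ((hρ a).2.1 x) (hσpos x).le) ?_ fun a ha => ?_
  · simp_rw [div_eq_mul_inv]
    rw [← finsum_mul' _ _ (hfin x)]
    exact mul_inv_cancel₀ (hσpos x).ne'
  · exact (hρ a).2.2.2 fun h => ha (by simp [h])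

end

/-! ### Invariant smooth functions on an ep-groupoid -/

section

variable {E : Type*} [NormedAddCommGroup E] [NormedSpace ℝ E]
  {H : Type*} [TopologicalSpace H] {I : ModelWithCorners ℝ E H}
  {O : Type*} [TopologicalSpace O] [ChartedSpace H O]
  {N : Type*} [TopologicalSpace N] [ChartedSpace H N]
  {F : Type*} [NormedAddCommGroup F] [NormedSpace ℝ F]

theorem IsLocalDiffeomorph.finite_inter_fiber {s : N → O} (hs : IsLocalDiffeomorph I I ∞ s)
    [T1Space O] {A : Set N} (hA : IsCompact A) (y : O) : (A ∩ s ⁻¹' {y}).Finite := by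
  choose Φ hΦ heq using hs
  have hcpt : IsCompact (A ∩ s ⁻¹' {y}) :=
    hA.inter_right (isClosed_singleton.preimage (IsLocalDiffeomorph.contMDiff
      (fun x => ⟨Φ x, hΦ x, heq x⟩ : IsLocalDiffeomorph I I ∞ s)).continuous)
  obtain ⟨T, hT, hsub⟩ := hcpt.elim_nhds_subcover (fun φ => (Φ φ).source)
    fun φ _ => (Φ φ).open_source.mem_nhds (hΦ φ)
  refine T.finite_toSet.subset fun φ hφ => ?_
  obtain ⟨χ, hχ, hφχ⟩ := mem_iUnion₂.1 (hsub hφ)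
  have h : s φ = s χ := hφ.2.trans (hT χ hχ).2.symm
  rw [heq χ hφχ, heq χ (hΦ χ)] at h
  exact (Φ χ).injOn hφχ (hΦ χ) h ▸ hχ

/-- The fibrewise sum of a smooth function along a local diffeomorphism is smooth near `y` if the
support of the function is compact over a neighbourhood of `y`: over a smaller neighbourhood the
sum has one term for each of the finitely many local inverses through the points over `y`. -/
theorem IsLocalDiffeomorph.contMDiffAt_finsum_fiber [T2Space O] [T2Space N] {s : N → O}
    (hs : IsLocalDiffeomorph I I ∞ s) {w : N → F} (hw : ContMDiff I 𝓘(ℝ, F) ∞ w) {y₀ : O}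
    {V : Set O} (hV : V ∈ 𝓝 y₀) {A : Set N} (hA : IsCompact A)
    (hwA : support w ∩ s ⁻¹' V ⊆ A) :
    ContMDiffAt I 𝓘(ℝ, F) ∞ (fun y => ∑ᶠ φ ∈ s ⁻¹' {y}, w φ) y₀ := by
  classical
  have hscont : Continuous s := hs.contMDiff.continuous
  have hfin := hs.finite_inter_fiber hA y₀
  choose Φ hΦ heq using hs
  obtain ⟨U, hU, hdisj⟩ := hfin.t2_separation
  set T := hfin.toFinset
  have hTs : ∀ φ ∈ T, s φ = y₀ := fun φ hφ => (hfin.mem_toFinset.1 hφ).2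
  have hTt : ∀ φ ∈ T, y₀ ∈ (Φ φ).target := by
    intro φ hφ
    rw [← hTs φ hφ, heq φ (hΦ φ)]
    exact (Φ φ).map_source (hΦ φ)
  have hTi : ∀ φ ∈ T, (Φ φ).symm y₀ = φ := by
    intro φ hφ
    rw [← hTs φ hφ, heq φ (hΦ φ)]
    exact (Φ φ).left_inv (hΦ φ)
  have hTsm : ∀ φ ∈ T, ContMDiffAt I I ∞ (Φ φ).symm y₀ := fun φ hφ =>
    (Φ φ).contMDiffOn_invFun.contMDiffAt ((Φ φ).open_target.mem_nhds (hTt φ hφ))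
  let D : N → Set N := fun φ => U φ ∩ (Φ φ).source
  have hD : ∀ φ, IsOpen (D φ) := fun φ => (hU φ).2.inter (Φ φ).open_source
  have hrest : ∀ᶠ y in 𝓝 y₀, y ∉ s '' (A \ ⋃ φ ∈ T, D φ) := by
    have hcpt : IsCompact (A \ ⋃ φ ∈ T, D φ) :=
      hA.diff (isOpen_biUnion fun φ _ => hD φ)
    refine (hcpt.image hscont).isClosed.isOpen_compl.mem_nhds ?_
    rintro ⟨φ, ⟨hφA, hφ⟩, hφy⟩
    exact hφ (mem_iUnion₂.2 ⟨φ, hfin.mem_toFinset.2 ⟨hφA, hφy⟩, (hU φ).1, hΦ φ⟩)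
  have hloc : ∀ᶠ y in 𝓝 y₀, ∀ φ ∈ T, y ∈ (Φ φ).target ∧ (Φ φ).symm y ∈ D φ := by
    refine (Finset.eventually_all T).2 fun φ hφ => ?_
    refine Eventually.and ((Φ φ).open_target.mem_nhds (hTt φ hφ))
      ((hTsm φ hφ).continuousAt.eventually ((hD φ).mem_nhds ?_))
    rw [hTi φ hφ]
    exact ⟨(hU φ).1, hΦ φ⟩
  have hsum : ContMDiffAt I 𝓘(ℝ, F) ∞ (fun y => ∑ φ ∈ T, w ((Φ φ).symm y)) y₀ :=
    contMDiffAt_finsetSum fun φ hφ => (hw _).comp y₀ (hTsm φ hφ)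
  refine hsum.congr_of_eventuallyEq ?_
  filter_upwards [hV, hrest, hloc] with y hyV hyr hyl
  have hsec : ∀ φ ∈ T, s ((Φ φ).symm y) = y := fun φ hφ => by
    rw [heq φ (hyl φ hφ).2.2]
    exact (Φ φ).right_inv (hyl φ hφ).1
  rw [finsum_mem_eq_sum_of_inter_support_eq (t := T.image fun φ => (Φ φ).symm y) w,
    Finset.sum_image]
  · intro φ hφ χ hχ h
    by_contra hne
    have := hdisj (hfin.mem_toFinset.1 hφ) (hfin.mem_toFinset.1 hχ) hne
    refine disjoint_left.1 this (hyl φ hφ).2.1 ?_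
    simp only at h
    rw [h]
    exact (hyl χ hχ).2.1
  · ext χ
    simp only [mem_inter_iff, Finset.coe_image, mem_image, and_congr_left_iff]
    refine fun hχ => ⟨fun hy => ?_, ?_⟩
    · have hy' : s χ = y := hy
      have hχA : χ ∈ A := hwA ⟨hχ, by rwa [mem_preimage, hy']⟩
      have : χ ∈ ⋃ φ ∈ T, D φ := by
        by_contra hcon
        exact hyr ⟨χ, ⟨hχA, hcon⟩, hy'⟩
      obtain ⟨φ, hφ, hχφ⟩ := mem_iUnion₂.1 this
      refine ⟨φ, hφ, ?_⟩
      rw [← hy', heq φ hχφ.2]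
      exact (Φ φ).left_inv hχφ.2
    · rintro ⟨φ, hφ, rfl⟩
      exact hsec φ hφ

end

namespace EpGroupoid

variable {E : Type*} [NormedAddCommGroup E] [NormedSpace ℝ E]
  {H : Type*} [TopologicalSpace H] {I : ModelWithCorners ℝ E H}
  {O : Type*} [TopologicalSpace O] [ChartedSpace H O]
  {Mor : Type*} [TopologicalSpace Mor] [ChartedSpace H Mor]

theorem isOpenMap_quotientMk (G : EpGroupoid I O Mor) :
    IsOpenMap (Quotient.mk G.orbitSetoid) := by
  intro U hU
  have h : Quotient.mk G.orbitSetoid ⁻¹' (Quotient.mk G.orbitSetoid '' U) =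
      G.t '' (G.s ⁻¹' U) := by
    ext y
    constructor
    · rintro ⟨x, hx, hxy⟩
      obtain ⟨φ, rfl, rfl⟩ := Quotient.exact hxy
      exact ⟨φ, hx, rfl⟩
    · rintro ⟨φ, hφ, rfl⟩
      exact ⟨G.s φ, hφ, Quotient.sound ⟨φ, rfl, rfl⟩⟩
  refine isQuotientMap_quotient_mk'.isOpen_preimage.1 ?_
  exact h ▸ G.isLocalDiffeomorph_t.isOpenMap _ (hU.preimage G.contMDiff_s.continuous)

/-- Composition with a morphism from `x` to `y` identifies the morphisms out of `y` with those
out of `x` without changing their targets. -/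
theorem finsum_source_fiber_eq (G : EpGroupoid I O Mor) {F : Type*} [AddCommMonoid F]
    (ψ : O → F) (χ : Mor) :
    ∑ᶠ φ ∈ G.s ⁻¹' {G.s χ}, ψ (G.t φ) = ∑ᶠ φ ∈ G.s ⁻¹' {G.t χ}, ψ (G.t φ) := by
  symm
  refine finsum_mem_eq_of_bijOn (fun φ => G.m φ χ) ⟨fun φ hφ => G.s_comp φ χ hφ, ?_, ?_⟩
    fun φ hφ => congrArg ψ (G.t_comp φ χ hφ).symm
  · intro φ (hφ : G.s φ = G.t χ) φ' (hφ' : G.s φ' = G.t χ) (h : G.m φ χ = G.m φ' χ)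
    have := congrArg (fun θ => G.m θ (G.i χ)) h
    simp only [G.assoc _ _ _ hφ (G.t_inv χ).symm, G.assoc _ _ _ hφ' (G.t_inv χ).symm,
      G.comp_inv] at this
    rwa [← hφ, G.comp_unit, hφ, ← hφ', G.comp_unit] at this
  · intro φ (hφ : G.s φ = G.s χ)
    have h : G.s φ = G.t (G.i χ) := hφ.trans (G.t_inv χ).symm
    refine ⟨G.m φ (G.i χ), (G.s_comp _ _ h).trans (G.s_inv χ), ?_⟩
    simp only
    rw [G.assoc _ _ _ h (G.s_inv χ), G.inv_comp, ← hφ, G.comp_unit]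

/-- A smooth function with compact support on the objects becomes an invariant smooth function
when it is summed over the targets of the morphisms out of each object. -/
theorem contMDiff_finsum_source_fiber (G : EpGroupoid I O Mor) [T2Space O] [T2Space Mor]
    {F : Type*} [NormedAddCommGroup F] [NormedSpace ℝ F] {ψ : O → F}
    (hψ : ContMDiff I 𝓘(ℝ, F) ∞ ψ) (hc : HasCompactSupport ψ) :
    ContMDiff I 𝓘(ℝ, F) ∞ (fun y => ∑ᶠ φ ∈ G.s ⁻¹' {y}, ψ (G.t φ)) := by
  intro y
  obtain ⟨V, hVo, hyV, hV⟩ := G.proper y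
  refine G.isLocalDiffeomorph_s.contMDiffAt_finsum_fiber (hψ.comp G.contMDiff_t)
    (hVo.mem_nhds hyV) ((hV.isCompact_preimage hc).image continuous_subtype_val) ?_
  rintro φ ⟨hφ, hφV⟩
  exact ⟨⟨φ, subset_closure hφV⟩, subset_tsupport ψ hφ, rfl⟩

theorem finite_source_fiber_inter_support (G : EpGroupoid I O Mor) [T2Space O]
    {F : Type*} [Zero F] {ψ : O → F} (hc : HasCompactSupport ψ) (y : O) :
    (G.s ⁻¹' {y} ∩ support fun φ => ψ (G.t φ)).Finite := by
  obtain ⟨V, hVo, hyV, hV⟩ := G.proper y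
  refine (G.isLocalDiffeomorph_s.finite_inter_fiber
    ((hV.isCompact_preimage hc).image continuous_subtype_val) y).subset ?_
  rintro φ ⟨hφy, hφ⟩
  refine ⟨⟨⟨φ, subset_closure ?_⟩, subset_tsupport ψ hφ, rfl⟩, hφy⟩
  rw [mem_preimage.1 hφy]
  exact hyV

theorem hasSmoothBumps_quotientMk (G : EpGroupoid I O Mor) [FiniteDimensional ℝ E]
    [IsManifold I ∞ O] [T2Space O] [T2Space Mor] :
    HasSmoothBumps I (Quotient.mk G.orbitSetoid) := by
  rintro ⟨x⟩ U hU
  obtain ⟨ψ, -, hψ⟩ := (SmoothBumpFunction.nhds_basis_support (I := I)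
    ((continuous_quotient_mk'.tendsto x) hU)).mem_iff.1
    ((continuous_quotient_mk'.tendsto x) hU)
  have hinv : ∀ y z, G.orbitSetoid y z →
      ∑ᶠ φ ∈ G.s ⁻¹' {y}, ψ (G.t φ) = ∑ᶠ φ ∈ G.s ⁻¹' {z}, ψ (G.t φ) := by
    rintro y z ⟨χ, rfl, rfl⟩
    exact G.finsum_source_fiber_eq ψ χ
  have hnn : ∀ y, 0 ≤ ∑ᶠ φ ∈ G.s ⁻¹' {y}, ψ (G.t φ) := fun y =>
    finsum_nonneg fun φ => finsum_nonneg fun _ => ψ.nonneg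
  refine ⟨Quotient.lift (fun y => ∑ᶠ φ ∈ G.s ⁻¹' {y}, ψ (G.t φ)) hinv,
    G.contMDiff_finsum_source_fiber ψ.contMDiff ψ.hasCompactSupport, ?_, ?_, ?_⟩
  · rintro ⟨y⟩
    exact hnn y
  · refine finsum_cond_pos (fun _ _ => ψ.nonneg) ⟨G.u x, G.s_unit x, ?_⟩ ?_
    · rw [G.t_unit, ψ.eq_one]
      exact one_pos
    · rw [inter_comm]
      exact G.finite_source_fiber_inter_support ψ.hasCompactSupport x
  · rintro ⟨y⟩ hy
    obtain ⟨φ, hφy, hφ⟩ := exists_ne_zero_of_finsum_mem_ne_zero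
      (show ∑ᶠ φ ∈ G.s ⁻¹' {y}, ψ (G.t φ) ≠ 0 from hy)
    have hφU := hψ hφ
    have : Quotient.mk G.orbitSetoid y = Quotient.mk G.orbitSetoid (G.t φ) :=
      Quotient.sound ⟨φ, hφy, rfl⟩
    exact (congrArg (· ∈ U) this).mpr hφU

end EpGroupoid

/-! ### Smoothing in one chart -/

/-- As the parameter space `K` is compact, there is a radius `r` such that, for all `y` near `x` and
all `t`, translating `h (y, t)` in the chart `e` by less than `r` does not leave the neighbourhood
`Q` of the graph. -/
theorem exists_forall_translate_mem {X : Type*} [TopologicalSpace X]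
    {M : Type*} [TopologicalSpace M] {E' : Type*} [NormedAddCommGroup E']
    {K : Type*} [TopologicalSpace K] [CompactSpace K] (e : OpenPartialHomeomorph M E')
    {Q : Set (X × M)} (hQ : IsOpen Q) {h : X × K → M}
    (hh : Continuous h) {x : X} (hx : ∀ t, h (x, t) ∈ e.source) (hxQ : ∀ t, (x, h (x, t)) ∈ Q) :
    ∃ r > 0, ∀ᶠ y in 𝓝 x, ∀ v : E', ‖v‖ < r → ∀ t,
      e (h (y, t)) + v ∈ e.target ∧ (y, e.symm (e (h (y, t)) + v)) ∈ Q := by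
  have key : ∀ᶠ z : X × E' in 𝓝 (x, 0), ∀ t ∈ (univ : Set K),
      e (h (z.1, t)) + z.2 ∈ e.target ∧ (z.1, e.symm (e (h (z.1, t)) + z.2)) ∈ Q := by
    refine isCompact_univ.eventually_forall_of_forall_eventually fun t _ => ?_
    have h1 : ContinuousAt (fun w : (X × E') × K => h (w.1.1, w.2)) ((x, 0), t) := by fun_prop
    have h2 : ContinuousAt (fun w : (X × E') × K => e (h (w.1.1, w.2)) + w.1.2) ((x, 0), t) :=
      (ContinuousAt.comp (f := fun w : (X × E') × K => h (w.1.1, w.2)) (x := ((x, 0), t))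
        (e.continuousAt (hx t)) h1).add (by fun_prop)
    have h0 : e (h (x, t)) + 0 ∈ e.target := by
      rw [add_zero]
      exact e.map_source (hx t)
    have h3 : ContinuousAt
        (fun w : (X × E') × K => (w.1.1, e.symm (e (h (w.1.1, w.2)) + w.1.2))) ((x, 0), t) :=
      ContinuousAt.prodMk (by fun_prop)
        (ContinuousAt.comp (g := e.symm) (e.continuousAt_symm h0) h2)
    refine Eventually.and (h2.eventually (e.open_target.mem_nhds h0))
      (h3.eventually (hQ.mem_nhds ?_))
    simpa only [add_zero, e.left_inv (hx t)] using hxQ t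
  obtain ⟨u, hu, v, hv, huv⟩ := mem_nhds_prod_iff.1 key
  obtain ⟨r, hr, hrv⟩ := Metric.mem_nhds_iff.1 hv
  refine ⟨r, hr, mem_of_superset hu fun y hy w hw t => ?_⟩
  exact huv (mk_mem_prod hy (hrv (mem_ball_zero_iff.2 hw))) t (mem_univ t)

section

variable {E : Type*} [NormedAddCommGroup E] [NormedSpace ℝ E]
  {H : Type*} [TopologicalSpace H] {I : ModelWithCorners ℝ E H}
  {O : Type*} [TopologicalSpace O] [ChartedSpace H O]
  {X : Type*} [TopologicalSpace X] {π : O → X}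
  {E' : Type*} [NormedAddCommGroup E'] [NormedSpace ℝ E']
  {M : Type*} [TopologicalSpace M] [ChartedSpace E' M]

/-- A homotopy `h` with graph in the open set `Q` can be changed, only over the open set `W` and
keeping its start, so that its end becomes smooth at the closed set `C ⊆ W` which `h` maps into the
domain of the chart `e`. Here *smooth at* a point of `X` refers to the pullback along `π` at its
preimages. The new homotopy is `e (h (x, t)) + t * l x • (g x - e (h (x, 1)))` in the chart, for a
cutoff function `l` and a smooth approximation `g` of the end of `h`; it does not change at `t = 0`
and, where `l = 1`, it is `g` at `t = 1`. -/
theorem HasSmoothBumps.exists_homotopy_contMDiffAt_of_mem_chart [T2Space X] [NormalSpace X]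
    [WeaklyLocallyCompactSpace X] [SigmaCompactSpace X]
    (hb : HasSmoothBumps I π) (hπ : Topology.IsQuotientMap π)
    {e : OpenPartialHomeomorph M E'} (he : e ∈ IsManifold.maximalAtlas 𝓘(ℝ, E') ∞ M)
    {Q : Set (X × M)} (hQ : IsOpen Q) {W C : Set X} (hW : IsOpen W) (hC : IsClosed C)
    (hCW : C ⊆ W) {h : X × unitInterval → M} (hh : Continuous h)
    (hhQ : ∀ x t, (x, h (x, t)) ∈ Q) (hhC : ∀ x ∈ C, ∀ t, h (x, t) ∈ e.source) :
    ∃ h' : X × unitInterval → M, Continuous h' ∧ (∀ x t, (x, h' (x, t)) ∈ Q) ∧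
      (∀ x, h' (x, 0) = h (x, 0)) ∧ (∀ x ∉ W, ∀ t, h' (x, t) = h (x, t)) ∧
      (∀ p, π p ∈ C → ContMDiffAt I 𝓘(ℝ, E') ∞ (fun q => h' (π q, 1)) p) ∧
      (∀ p, ContMDiffAt I 𝓘(ℝ, E') ∞ (fun q => h (π q, 1)) p →
        ContMDiffAt I 𝓘(ℝ, E') ∞ (fun q => h' (π q, 1)) p) := by
  classical
  let D : Set X := {x | x ∈ W ∧ ∀ t, h (x, t) ∈ e.source}
  have hD : IsOpen D := by
    refine hW.inter (isOpen_iff_mem_nhds.2 fun x hx => ?_)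
    have := (isCompact_univ (X := unitInterval)).eventually_forall_of_forall_eventually
      (x₀ := x) (P := fun y t => h (y, t) ∈ e.source)
      fun t _ => hh.continuousAt.eventually (e.open_source.mem_nhds (hx t))
    exact this.mono fun y hy t => hy t (mem_univ t)
  obtain ⟨B₁, hB₁, hCB₁, hB₁D⟩ := normal_exists_closure_subset hC hD
    fun x hx => ⟨hCW hx, hhC x hx⟩
  obtain ⟨B₂, hB₂, hB₁B₂, hB₂D⟩ := normal_exists_closure_subset isClosed_closure hD hB₁D
  set A := closure B₂
  have hAc : IsClosed A := isClosed_closure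
  have heh : ∀ {x}, x ∈ D → ∀ t, ContinuousAt (fun z => e (h z)) (x, t) := fun hx t =>
    ContinuousAt.comp (g := e) (e.continuousAt (hx.2 t)) hh.continuousAt
  have heh1 : ∀ {x}, x ∈ D → ContinuousAt (fun y => e (h (y, 1))) x := fun {x} hx =>
    ContinuousAt.comp (f := fun y => (y, (1 : unitInterval))) (heh hx 1) (by fun_prop)
  -- a cutoff function
  obtain ⟨l, hlc, hls, hl⟩ := hb.exists_forall_mem_convex hπ
    (t := fun x => {r : ℝ | (0 ≤ r ∧ r ≤ 1) ∧ (x ∈ closure B₁ → r = 1) ∧ (x ∉ B₂ → r = 0)}) (by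
      intro x
      refine OrdConnected.convex ⟨fun r hr r' hr' ρ hρ => ⟨⟨hr.1.1.trans hρ.1,
        hρ.2.trans hr'.1.2⟩, fun hx => ?_, fun hx => ?_⟩⟩
      · exact le_antisymm (hρ.2.trans_eq (hr'.2.1 hx)) ((hr.2.1 hx).ge.trans hρ.1)
      · exact le_antisymm (hρ.2.trans_eq (hr'.2.2 hx)) ((hr.2.2 hx).ge.trans hρ.1)) (by
      intro x
      by_cases hx : x ∈ closure B₁
      · refine ⟨1, ?_⟩
        filter_upwards [hB₂.mem_nhds (hB₁B₂ hx)] with y hy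
        simp [hy]
      · refine ⟨0, ?_⟩
        filter_upwards [isClosed_closure.isOpen_compl.mem_nhds hx] with y hy
        simpa using fun h => absurd h hy)
  -- how far the points of `A` can be moved in the chart without leaving `Q`
  obtain ⟨ε, hεc, -, hε⟩ := hb.exists_forall_mem_convex hπ
    (t := fun x => {r : ℝ | 0 < r ∧ (x ∈ A → ∀ v : E', ‖v‖ < r → ∀ t,
      e (h (x, t)) + v ∈ e.target ∧ (x, e.symm (e (h (x, t)) + v)) ∈ Q)}) (by
      intro x
      refine OrdConnected.convex ⟨fun r hr r' hr' ρ hρ => ⟨hr.1.trans_le hρ.1, ?_⟩⟩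
      exact fun hx v hv => hr'.2 hx v (hv.trans_le hρ.2)) (by
      intro x
      by_cases hx : x ∈ A
      · obtain ⟨r, hr, hev⟩ := exists_forall_translate_mem e hQ hh (hB₂D hx).2 (hhQ x)
        exact ⟨r, hev.mono fun y hy => ⟨hr, fun _ => hy⟩⟩
      · exact ⟨1, Eventually.mono (p := (· ∈ Aᶜ)) (hAc.isOpen_compl.mem_nhds hx)
          fun y hy => ⟨one_pos, fun h => absurd h hy⟩⟩)
  -- a smooth approximation of `h (·, 1)` in the chart
  obtain ⟨g, hgc, hgs, hg⟩ := hb.exists_forall_mem_convex hπ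
    (t := fun x => {v : E' | x ∈ A → ‖v - e (h (x, 1))‖ < ε x}) (by
      intro x
      by_cases hx : x ∈ A
      · simpa [hx, Metric.ball, dist_eq_norm] using convex_ball (e (h (x, 1))) (ε x)
      · simp [hx, convex_univ]) (by
      intro x
      by_cases hx : x ∈ A
      · refine ⟨e (h (x, 1)), ?_⟩
        have : ContinuousAt (fun y => ‖e (h (x, 1)) - e (h (y, 1))‖) x :=
          (continuousAt_const.sub (heh1 (hB₂D hx))).norm
        filter_upwards [this.eventually_lt hεc.continuousAt (by simpa using (hε x).1)] with y hy
        exact fun _ => hy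
      · exact ⟨0, Eventually.mono (p := (· ∈ Aᶜ)) (hAc.isOpen_compl.mem_nhds hx)
          fun y hy h => absurd h hy⟩)
  let v : X × unitInterval → E' := fun z => ((z.2 : ℝ) * l z.1) • (g z.1 - e (h (z.1, 1)))
  let k : X × unitInterval → M := fun z => e.symm (e (h z) + v z)
  have hv : ∀ {x}, x ∈ A → ∀ t, ‖v (x, t)‖ < ε x := by
    intro x hx t
    refine lt_of_le_of_lt ?_ (hg x hx)
    simp only [v, norm_smul, norm_mul, Real.norm_eq_abs, abs_of_nonneg t.2.1,
      abs_of_nonneg (hl x).1.1]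
    exact mul_le_of_le_one_left (norm_nonneg _)
      (mul_le_one₀ t.2.2 (hl x).1.1 (hl x).1.2)
  have hk : ∀ {x}, x ∈ A → ∀ t, e (h (x, t)) + v (x, t) ∈ e.target ∧ (x, k (x, t)) ∈ Q :=
    fun {x} hx t => (hε x).2 hx _ (hv hx t) t
  let h' : X × unitInterval → M := fun z => if z.1 ∈ A then k z else h z
  have hvA : ∀ {x}, x ∉ A → ∀ t, v (x, t) = 0 := by
    intro x hx t
    simp [v, (hl x).2.2 fun hx' => hx (subset_closure hx')]
  have hh'D : ∀ {x}, x ∈ D → ∀ t, h' (x, t) = k (x, t) := by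
    intro x hx t
    by_cases hxA : x ∈ A
    · simp [h', hxA]
    · simp [h', k, hxA, hvA hxA, e.left_inv (hx.2 t)]
  have hh'A : ∀ {x}, x ∉ A → ∀ t, h' (x, t) = h (x, t) := fun hx t => by simp [h', hx]
  have hDev : ∀ {x}, x ∈ A → ∀ᶠ y in 𝓝 x, y ∈ D := fun hx => hD.mem_nhds (hB₂D hx)
  have hAev : ∀ {x}, x ∉ A → ∀ᶠ y in 𝓝 x, y ∉ A := fun hx => hAc.isOpen_compl.mem_nhds hx
  have hsymm : ∀ {y}, y ∈ e.target → ContMDiffAt 𝓘(ℝ, E') 𝓘(ℝ, E') ∞ e.symm y := fun hy =>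
    (contMDiffOn_symm_of_mem_maximalAtlas he).contMDiffAt (e.open_target.mem_nhds hy)
  refine ⟨h', continuous_iff_continuousAt.2 ?_, ?_, ?_, ?_, ?_, ?_⟩
  · rintro ⟨x, t⟩
    by_cases hx : x ∈ A
    · have h1 : ContinuousAt v (x, t) := by
        refine ContinuousAt.smul (by fun_prop) (ContinuousAt.sub (by fun_prop) ?_)
        exact ContinuousAt.comp (f := fun z : X × unitInterval => z.1)
          (heh1 (hB₂D hx)) continuousAt_fst
      have h2 : ContinuousAt k (x, t) := ContinuousAt.comp (g := e.symm)
        (e.continuousAt_symm (hk hx t).1) ((heh (hB₂D hx) t).add h1)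
      refine h2.congr ?_
      filter_upwards [continuousAt_fst.eventually (hDev hx)] with z hz
      exact (hh'D hz z.2).symm
    · refine hh.continuousAt.congr ?_
      filter_upwards [continuousAt_fst.eventually (hAev hx)] with z hz
      exact (hh'A hz z.2).symm
  · intro x t
    by_cases hx : x ∈ A
    · rw [hh'D (hB₂D hx)]
      exact (hk hx t).2
    · rw [hh'A hx]
      exact hhQ x t
  · intro x
    by_cases hx : x ∈ A
    · rw [hh'D (hB₂D hx)]
      simp [k, v, e.left_inv ((hB₂D hx).2 0)]
    · exact hh'A hx 0
  · exact fun x hx t => hh'A (fun hxA => hx (hB₂D hxA).1) t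
  · intro p hp
    have hpA : π p ∈ A := subset_closure (hB₁B₂ (subset_closure (hCB₁ hp)))
    have hgt : e (h (π p, 1)) + v (π p, 1) = g (π p) := by
      simp [v, (hl _).2.1 (subset_closure (hCB₁ hp))]
    have h1 : ContMDiffAt I 𝓘(ℝ, E') ∞ (fun q => e.symm (g (π q))) p := by
      refine ContMDiffAt.comp (g := e.symm) p (hsymm ?_) (hgs p)
      exact hgt ▸ (hk hpA 1).1
    refine h1.congr_of_eventuallyEq ?_
    filter_upwards [hπ.continuous.continuousAt.eventually (hDev hpA),
      hπ.continuous.continuousAt.eventually (hB₁.mem_nhds (hCB₁ hp))] with q hq hq'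
    simp [hh'D hq, k, v, (hl _).2.1 (subset_closure hq')]
  · intro p hp
    by_cases hpA : π p ∈ A
    · have h1 : ContMDiffAt I 𝓘(ℝ, E') ∞ (fun q => e (h (π q, 1))) p :=
        ContMDiffAt.comp (g := e) (I' := 𝓘(ℝ, E')) p
          (contMDiffAt_of_mem_maximalAtlas he ((hB₂D hpA).2 1)) hp
      have h2 : ContMDiffAt I 𝓘(ℝ, E') ∞ (fun q => k (π q, 1)) p := by
        refine ContMDiffAt.comp (g := e.symm) (I' := 𝓘(ℝ, E')) p (hsymm (hk hpA 1).1) ?_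
        have h3 : ContMDiffAt I 𝓘(ℝ, ℝ) ∞ (fun q => ((1 : unitInterval) : ℝ) * l (π q)) p := by
          simpa [comp_def] using hls p
        exact h1.add (h3.smul ((hgs p).sub h1))
      refine h2.congr_of_eventuallyEq ?_
      filter_upwards [hπ.continuous.continuousAt.eventually (hDev hpA)] with q hq
      exact hh'D hq 1
    · refine hp.congr_of_eventuallyEq ?_
      filter_upwards [hπ.continuous.continuousAt.eventually (hAev hpA)] with q hq
      exact hh'A hq 1

end

/-! ### Smoothing over all charts -/

section

variable {E : Type*} [NormedAddCommGroup E] [NormedSpace ℝ E]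
  {H : Type*} [TopologicalSpace H] {I : ModelWithCorners ℝ E H}
  {O : Type*} [TopologicalSpace O] [ChartedSpace H O]
  {X : Type*} [TopologicalSpace X] {π : O → X}
  {E' : Type*} [NormedAddCommGroup E'] [NormedSpace ℝ E']
  {M : Type*} [TopologicalSpace M] [ChartedSpace E' M]

/-- A nonempty manifold has a locally finite open cover `U` indexed by `ℕ`, with a closed shrinking
`K`, whose members lie in compact subsets `L n` of chart domains. -/
theorem exists_nat_chart_cover [FiniteDimensional ℝ E'] [T2Space M] [SecondCountableTopology M]
    [Nonempty M] :
    ∃ (c : ℕ → M) (U K L : ℕ → Set M), LocallyFinite U ∧ (∀ n, IsOpen (U n)) ∧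
      (∀ n, IsClosed (K n)) ∧ (∀ n, IsCompact (L n)) ∧ (∀ n, K n ⊆ U n) ∧ (∀ n, U n ⊆ L n) ∧
      (∀ n, L n ⊆ (chartAt E' (c n)).source) ∧ ⋃ n, K n = univ := by
  have : LocallyCompactSpace M := ChartedSpace.locallyCompactSpace E' M
  choose L hL hxL hLs using fun x : M =>
    exists_compact_subset (chartAt E' x).open_source (mem_chart_source E' x)
  obtain ⟨s, hs, hsL⟩ := TopologicalSpace.countable_cover_nhds
    fun x => isOpen_interior.mem_nhds (hxL x)
  obtain ⟨x, hx, -⟩ := mem_iUnion₂.1 (hsL.symm ▸ mem_univ (Classical.arbitrary M))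
  obtain ⟨c, rfl⟩ := hs.exists_eq_range ⟨x, hx⟩
  rw [biUnion_range] at hsL
  obtain ⟨U, hU, hUc, hUl, hUL⟩ := precise_refinement (fun n => interior (L (c n)))
    (fun _ => isOpen_interior) hsL
  obtain ⟨K, hK, hKc, hKU⟩ := exists_iUnion_eq_closed_subset hU hUl.point_finite hUc
  exact ⟨c, U, K, fun n => L (c n), hUl, hU, hKc, fun n => hL _, hKU,
    fun n => (hUL n).trans interior_subset, fun n => hLs _, hK⟩

/-- Whitney approximation for a quotient map `π : O → X` from a manifold, relative to the functions
on `X` whose pullback along `π` is smooth. -/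
theorem HasSmoothBumps.exists_contMDiff_homotopic [T2Space X] [NormalSpace X]
    [WeaklyLocallyCompactSpace X] [SigmaCompactSpace X]
    (hb : HasSmoothBumps I π) (hπ : Topology.IsQuotientMap π) [FiniteDimensional ℝ E']
    [IsManifold 𝓘(ℝ, E') ∞ M] [T2Space M] [SecondCountableTopology M] (f : C(X, M)) :
    ∃ h : C(X, M), ContMDiff I 𝓘(ℝ, E') ∞ (h ∘ π) ∧ h.Homotopic f ∧
      (IsProperMap f → IsProperMap h) := by
  rcases isEmpty_or_nonempty M with hM | hM
  · exact ⟨f, fun p => isEmptyElim (f (π p)), .refl f, id⟩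
  have : LocallyCompactSpace M := ChartedSpace.locallyCompactSpace E' M
  obtain ⟨c, U, K, L, hUl, hU, hK, hL, hKU, hUL, hLc, hKcov⟩ :=
    exists_nat_chart_cover (M := M) (E' := E')
  have hKx : ∀ y, ∃ j, y ∈ K j := fun y => mem_iUnion.1 (hKcov ▸ mem_univ y)
  -- The first condition keeps `f ⁻¹' K j` inside the `j`-th chart until step `j`, and the second one
  -- keeps the deformed map and `f` in a common `U j`, which is what properness needs.
  let Q : Set (X × M) :=
    {z | (∀ j, f z.1 ∈ K j → z.2 ∈ U j) ∧ ∃ j, f z.1 ∈ U j ∧ z.2 ∈ U j}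
  have hQ : IsOpen Q := by
    have hlf : LocallyFinite fun j => (f ⁻¹' K j) ×ˢ (U j)ᶜ :=
      ((hUl.subset hKU).preimage_continuous f.continuous).prod_right _
    have h1 : IsOpen (⋃ j, (f ⁻¹' K j) ×ˢ (U j)ᶜ)ᶜ := (hlf.isClosed_iUnion fun j =>
      ((hK j).preimage f.continuous).prod (hU j).isClosed_compl).isOpen_compl
    have h2 : IsOpen (⋃ j, (f ⁻¹' U j) ×ˢ U j) :=
      isOpen_iUnion fun j => ((hU j).preimage f.continuous).prod (hU j)
    convert h1.inter h2 using 1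
    ext z
    simp [Q]
  let S := {h : X × unitInterval → M // Continuous h ∧ ∀ x t, (x, h (x, t)) ∈ Q}
  have hstep : ∀ (n : ℕ) (h : S), ∃ h' : S, (∀ x, h'.1 (x, 0) = h.1 (x, 0)) ∧
      (∀ x ∉ f ⁻¹' U n, ∀ t, h'.1 (x, t) = h.1 (x, t)) ∧
      (∀ p, π p ∈ f ⁻¹' K n → ContMDiffAt I 𝓘(ℝ, E') ∞ (fun q => h'.1 (π q, 1)) p) ∧
      (∀ p, ContMDiffAt I 𝓘(ℝ, E') ∞ (fun q => h.1 (π q, 1)) p →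
        ContMDiffAt I 𝓘(ℝ, E') ∞ (fun q => h'.1 (π q, 1)) p) := by
    rintro n ⟨h, hh, hhQ⟩
    obtain ⟨h', hh', hhQ', hprop⟩ := hb.exists_homotopy_contMDiffAt_of_mem_chart hπ
      (IsManifold.chart_mem_maximalAtlas (I := 𝓘(ℝ, E')) (n := ∞) (c n)) hQ
      ((hU n).preimage f.continuous) ((hK n).preimage f.continuous) (preimage_mono (hKU n)) hh hhQ
      fun x hx t => hLc n (hUL n ((hhQ x t).1 n hx))
    exact ⟨⟨h', hh', hhQ'⟩, hprop⟩
  choose nxt hnxt0 hnxtU hnxtK hnxts using hstep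
  let h₀ : S := ⟨fun z => f z.1, by fun_prop, fun x _ => ⟨fun j hj => hKU j hj, by
    obtain ⟨j, hj⟩ := hKx (f x)
    exact ⟨j, hKU j hj, hKU j hj⟩⟩⟩
  let a : ℕ → S := fun n => Nat.rec h₀ nxt n
  have hlf : LocallyFinite fun n => {z | (a (n + 1)).1 z ≠ (a n).1 z} := by
    refine (hUl.preimage_continuous (f.continuous.comp continuous_fst)).subset fun n z hz => ?_
    by_contra hzU
    exact hz (hnxtU n (a n) z.1 hzU z.2)
  obtain ⟨F, hF⟩ := hlf.exists_forall_eventually_atTop_eventuallyEq (f := fun n => (a n).1)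
  have hFpt : ∀ z, ∃ n, (a n).1 z = F z := fun z =>
    ((hF z).mono fun n hn => hn.self_of_nhds).exists
  have hFc : Continuous F := continuous_iff_continuousAt.2 fun z => by
    obtain ⟨n, hn⟩ := (hF z).exists
    exact (a n).2.1.continuousAt.congr hn
  have hFQ : ∀ x t, (x, F (x, t)) ∈ Q := fun x t => by
    obtain ⟨n, hn⟩ := hFpt (x, t)
    exact hn ▸ (a n).2.2 x t
  have ha0 : ∀ n x, (a n).1 (x, 0) = f x := by
    intro n x
    induction n with
    | zero => rfl
    | succ n ih => exact (hnxt0 n (a n) x).trans ih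
  have hF0 : ∀ x, F (x, 0) = f x := fun x => by
    obtain ⟨n, hn⟩ := hFpt (x, 0)
    exact hn ▸ ha0 n x
  have hFs : ContMDiff I 𝓘(ℝ, E') ∞ fun q => F (π q, 1) := by
    intro p
    obtain ⟨j, hj⟩ := hKx (f (π p))
    obtain ⟨n, hn, hjn⟩ := ((hF (π p, 1)).and (eventually_ge_atTop (j + 1))).exists
    have han : ∀ m ≥ j + 1, ContMDiffAt I 𝓘(ℝ, E') ∞ (fun q => (a m).1 (π q, 1)) p := by
      intro m hm
      induction m, hm using Nat.le_induction with
      | base => exact hnxtK j (a j) p hj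
      | succ m _ ih => exact hnxts m (a m) p ih
    refine (han n hjn).congr_of_eventuallyEq ?_
    have : ContinuousAt (fun q => (π q, (1 : unitInterval))) p :=
      (hπ.continuous.prodMk continuous_const).continuousAt
    exact (this.eventually hn).mono fun q hq => hq.symm
  let h : C(X, M) := ⟨fun x => F (x, 1), by fun_prop⟩
  refine ⟨h, hFs, ContinuousMap.Homotopic.symm ⟨⟨⟨fun z => F (z.2, z.1), by fun_prop⟩,
    hF0, fun _ => rfl⟩⟩, fun hf => ?_⟩
  refine isProperMap_iff_isCompact_preimage.2 ⟨h.continuous, fun {K'} hK' => ?_⟩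
  have hfin := hUl.finite_nonempty_inter_compact hK'
  refine (hf.isCompact_preimage (hfin.isCompact_biUnion fun j _ => hL j)).of_isClosed_subset
    (hK'.isClosed.preimage h.continuous) fun x hx => ?_
  obtain ⟨j, hj, hj'⟩ := (hFQ x 1).2
  exact mem_iUnion₂.2 ⟨j, ⟨_, hj', hx⟩, hUL j hj⟩

end

/-! ### Functors into a trivial orbifold structure -/

section

variable {E : Type*} [NormedAddCommGroup E] [NormedSpace ℝ E]
  {H : Type*} [TopologicalSpace H] {I : ModelWithCorners ℝ E H}
  {O : Type*} [TopologicalSpace O] [ChartedSpace H O]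

theorem HasSmoothBumps.homeomorph_comp {X Y : Type*} [TopologicalSpace X] [TopologicalSpace Y]
    {π : O → X} (hb : HasSmoothBumps I π) (e : X ≃ₜ Y) : HasSmoothBumps I (e ∘ π) := by
  intro y U hU
  obtain ⟨g, hg, hnn, hpos, hsupp⟩ := hb (e.symm y) (e ⁻¹' U)
    (e.continuous.continuousAt (by rwa [e.apply_symm_apply]))
  refine ⟨g ∘ e.symm, ?_, fun z => hnn _, hpos, fun z hz => ?_⟩
  · simpa [comp_def] using hg
  · simpa using hsupp (show e.symm z ∈ support g from hz)

/-- A map from the underlying space of an orbifold to a manifold whose pullback to the objects is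
smooth is induced by a smooth functor into the trivial orbifold structure. -/
theorem OrbifoldStructure.exists_inducedMap_eq
    {Mor : Type*} [TopologicalSpace Mor] [ChartedSpace H Mor]
    {X : Type*} [TopologicalSpace X] (S : OrbifoldStructure I O Mor X)
    {E' : Type*} [NormedAddCommGroup E'] [NormedSpace ℝ E']
    {H' : Type*} [TopologicalSpace H'] {I' : ModelWithCorners ℝ E' H'}
    {M : Type*} [TopologicalSpace M] [ChartedSpace H' M] (h : C(X, M))
    (hs : ContMDiff I I' ∞ fun x => h (S.homeo (Quotient.mk _ x))) :
    ∃ F : EpFunctor ∞ S.groupoid (OrbifoldStructure.trivial I' M).groupoid,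
      EpFunctor.inducedMap F = h := by
  have hinv : ∀ φ, h (S.homeo (Quotient.mk _ (S.groupoid.s φ))) =
      h (S.homeo (Quotient.mk _ (S.groupoid.t φ))) := fun φ =>
    congrArg (fun z => h (S.homeo z)) (Quotient.sound ⟨φ, rfl, rfl⟩)
  let F : EpFunctor ∞ S.groupoid (OrbifoldStructure.trivial I' M).groupoid := {
    obj := fun x => h (S.homeo (Quotient.mk _ x))
    mor := fun φ => h (S.homeo (Quotient.mk _ (S.groupoid.s φ)))
    s_mor := fun _ => rfl
    t_mor := hinv
    mor_unit := fun x => by rw [S.groupoid.s_unit]; rfl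
    mor_comp := fun φ ψ hφψ => by
      rw [S.groupoid.s_comp φ ψ hφψ, hinv ψ, ← hφψ]
      rfl
    contMDiff_obj := hs
    contMDiff_mor := hs.comp S.groupoid.contMDiff_s }
  refine ⟨F, ContinuousMap.ext fun x => ?_⟩
  obtain ⟨z, rfl⟩ := S.homeo.surjective x
  obtain ⟨p, rfl⟩ := Quotient.exists_rep z
  exact congrArg (fun z => (OrbifoldStructure.trivial I' M).homeo (F.orbitMap z))
    (S.homeo.symm_apply_apply _)

end

/-! ### Whitney approximation for orbifolds -/

theorem theorem2p4
    -- the model of the manifolds of objects and of morphisms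
    {E : Type*} [NormedAddCommGroup E] [NormedSpace ℝ E] [FiniteDimensional ℝ E]
    {H : Type*} [TopologicalSpace H] {I : ModelWithCorners ℝ E H}
    -- the manifold of objects
    {O : Type*} [TopologicalSpace O] [ChartedSpace H O] [IsManifold I ∞ O]
    [T2Space O] [ParacompactSpace O]
    -- the manifold of morphisms
    {Mor : Type*} [TopologicalSpace Mor] [ChartedSpace H Mor] [IsManifold I ∞ Mor]
    [T2Space Mor] [ParacompactSpace Mor]
    -- the underlying space `X` of the orbifold, and its orbifold structure
    {X : Type*} [TopologicalSpace X] [SecondCountableTopology X] [ParacompactSpace X] [T2Space X]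
    (S : OrbifoldStructure I O Mor X)
    -- the target manifold
    {n : ℕ} {M : Type*} [TopologicalSpace M] [ChartedSpace (EuclideanSpace ℝ (Fin n)) M]
    [IsManifold (𝓡 n) ∞ M] [T2Space M] [SecondCountableTopology M]
    (f : C(X, M)) :
    ∃ F : EpFunctor ∞ S.groupoid (OrbifoldStructure.trivial (𝓡 n) M).groupoid,
      (EpFunctor.inducedMap F).Homotopic f ∧
      (IsProperMap f → IsProperMap (EpFunctor.inducedMap F)) := by
  have : LocallyCompactSpace O := Manifold.locallyCompact_of_finiteDimensional I
  set π : O → X := S.homeo ∘ Quotient.mk S.groupoid.orbitSetoid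
  have hπ : Topology.IsQuotientMap π := S.homeo.isQuotientMap.comp isQuotientMap_quotient_mk'
  have hπo : IsOpenMap π := S.homeo.isOpenMap.comp S.groupoid.isOpenMap_quotientMk
  have : WeaklyLocallyCompactSpace X := ⟨fun x => by
    obtain ⟨p, rfl⟩ := hπ.surjective x
    obtain ⟨K, hK, hKp⟩ := exists_compact_mem_nhds p
    exact ⟨π '' K, hK.image hπ.continuous, hπo.image_mem_nhds hKp⟩⟩
  obtain ⟨h, hs, hh, hp⟩ := HasSmoothBumps.exists_contMDiff_homotopic
    (E' := EuclideanSpace ℝ (Fin n))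
    (S.groupoid.hasSmoothBumps_quotientMk.homeomorph_comp S.homeo) hπ f
  obtain ⟨F, rfl⟩ := S.exists_inducedMap_eq h hs
  exact ⟨F, hh, hp⟩
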